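/- All graphs are finite and simple. A graph $\Gamma$ is \emph{$(c,t)$-sparse} if for all (not necessarily disjoint) vertex sets $A,B\subseteq V(\Gamma)$ with $|A|,|B|\ge t$, the number of pairs $(a,b)\in A\times B$ with $ab\in E(\Gamma)$ is at most $(1-c)|A||B|$. A graph property (a family of graphs closed under isomorphism) is \emph{hereditary} if it is closed under taking induced subgraphs, and \emph{nontrivial} if it contains all edgeless graphs and misses some graph. For a nontrivial hereditary property $\mathcal P$, $\mathrm{ex}(\Gamma,\mathcal P)$ denotes the maximum number of edges of a subgraph $G\subseteq\Gamma$ that belongs to $\mathcal P$. 1. For every graph $H$ and every real $c>0$ there is a constant $C=C(c,H)>0$ such that the following holds. Let $d\ge 1$ be an integer such that $H$ is bipartite with a bipartition in which all vertices of one part have degree at most $d$, and let $\Gamma$ be a $(c,t)$-sparse graph on $n\ge 1$ vertices for some real $t>0$. Then every subgraph $G\subseteq\Gamma$ with at least $C\,t^{1/d}n^{2-1/d}$ edges contains a copy of $H$ which is induced in $\Gamma$, that is, there is a set of vertices of $G$ on which the subgraph of $\Gamma$ induced is isomorphic to $H$ and has all its edges in $G$. 2. Let $\mathcal P$ be a nontrivial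 hereditary property that misses some bipartite graph. Then there is $\varepsilon=\varepsilon(\mathcal P)>0$ such that for every fixed $0<p<1$, with probability tending to $1$ as $n\to\infty$, the binomial random graph $\Gamma=G(n,p)$ satisfies $\mathrm{ex}(\Gamma,\mathcal P)\le n^{2-\varepsilon}$. -/

import Mathlib

open Filter Topology

universe u v

namespace InducedTuran

/-- `Γ` is `(c, t)`-sparse: for all vertex sets `A`, `B` (not necessarily disjoint) with at least `t`
elements each, the number of pairs `(a, b) ∈ A × B` with `a` adjacent to `b` is at most
`(1 - c) |A| |B|`. -/
def IsSparse {V : Type u} (Γ : SimpleGraph V) (c t : ℝ) : Prop :=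
  open Classical in
  ∀ A B : Finset V, t ≤ (A.card : ℝ) → t ≤ (B.card : ℝ) →
    ((Γ.interedges A B).card : ℝ) ≤ (1 - c) * (A.card : ℝ) * (B.card : ℝ)

/-- `H` is bipartite, and admits a bipartition `(A, B)` of its vertex set in which all vertices
of the part `A` have degree at most `d`. -/
def IsBipartiteDegreeLE {W : Type u} (H : SimpleGraph W) (d : ℕ) : Prop :=
  ∃ A B : Set W, H.IsBipartiteWith A B ∧ A ∪ B = Set.univ ∧
    ∀ a ∈ A, (H.neighborSet a).ncard ≤ d

/-- The subgraph `G` of `Γ` contains a copy of `H` which is induced in `Γ`: the vertices and the edges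
of the copy belong to `G`, and no two vertices of the copy are joined by any other edge of `Γ`. -/
def HasCopyInducedIn {W : Type u} {V : Type v} (H : SimpleGraph W) (Γ : SimpleGraph V)
    (G : Γ.Subgraph) : Prop :=
  ∃ f : H ↪g Γ, (∀ w, f w ∈ G.verts) ∧ ∀ w w', H.Adj w w' → G.Adj (f w) (f w')

/-- A family of finite graphs. -/
abbrev GraphProperty : Type 1 := ∀ (V : Type) [Finite V], SimpleGraph V → Prop

/-- A graph property is hereditary if it is closed under taking induced subgraphs
(and under isomorphism, as every graph property). -/
def GraphProperty.IsHereditary (P : GraphProperty) : Prop :=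
  ∀ (V W : Type) [Finite V] [Finite W] (G : SimpleGraph V) (G' : SimpleGraph W),
    G.IsIndContained G' → P W G' → P V G

/-- A graph property is nontrivial if it contains all edgeless graphs and misses some graph. -/
def GraphProperty.IsNontrivial (P : GraphProperty) : Prop :=
  (∀ (V : Type) [Finite V], P V ⊥) ∧ ∃ (W : Type) (_ : Finite W) (H : SimpleGraph W), ¬ P W H

/-- The graph property `P` misses some bipartite graph. -/
def GraphProperty.MissesBipartite (P : GraphProperty) : Prop :=
  ∃ (W : Type) (_ : Finite W) (H : SimpleGraph W), H.IsBipartite ∧ ¬ P W H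

/-- `ex(Γ, P)`: the maximum number of edges of a subgraph `G ⊆ Γ` that belongs to `P`. The set is
bounded, and for a nontrivial `P` it is nonempty, so that the supremum is a maximum. -/
noncomputable def ex {V : Type} [Finite V] (Γ : SimpleGraph V) (P : GraphProperty) : ℕ :=
  sSup {k : ℕ | ∃ G : Γ.Subgraph, P G.verts G.coe ∧ G.edgeSet.ncard = k}

end InducedTuran

/-! Dependent random choice, adapted to induced copies. Sparsity makes "equal or adjacent in `Γ`" a
spread relation (`IsSparse.isSpread`): only few vertices are related to nearly all of a large set.
Hence a proportion `ε` of the `k`-tuples in a large set is independent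
(`IsSpread.exists_card_independent_ge`), and large sets have an independent transversal
(`IsSpread.exists_transversal`). If `G` is dense enough, the common neighbourhood `U` of some
`d`-tuple is large, and all but a proportion `δ` of its `d`-tuples have many common neighbours in
`G` (`exists_rich_set`). As `δ` may be chosen after `ε`, some independent tuple `f` in `U` has all
the relevant `d`-subtuples rich, and each common neighbourhood stays large once the vertices related
to the other `f i` are deleted (`exists_induced_configuration`). One part of `H` goes to entries of
`f`, the other, of degrees at most `d`, to an independent transversal of the trimmed neighbourhoods.
For `G(n,p)`, an exponential moment bound and a union bound over pairs of sets give `(c,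
n^(3/4))`-sparsity with high probability. The first part then yields about `n^(2 - 1/(4d))` edges,
with `d` depending only on the missed graph, and a copy induced in `Γ` with its edges in `G` is
induced in `G`. -/

namespace InducedTuran


/-! ### Spread relations: independent tuples and transversals -/

open Finset Classical in
/-- Every set `X` with at least `t` elements has fewer than `t` vertices that are `R`-unrelated to
less than a proportion `c` of `X`. -/
def IsSpread {V : Type v} [Fintype V] (R : V → V → Prop) (c t : ℝ) : Prop :=
  ∀ X : Finset V, t ≤ (#X : ℝ) →
    (#{u : V | (#{x ∈ X | ¬ R u x} : ℝ) < c * #X} : ℝ) < t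

-- Greedy choice: a representative of one set is taken outside the fewer than `t` bad vertices of
-- each other set, and these sets shrink to what is unrelated to it. Each choice costs a factor `c`,
-- whence `c ^ #S`.
open Finset Classical in
theorem IsSpread.exists_transversal {V : Type v} [Fintype V] [Nonempty V] {R : V → V → Prop}
    {c t M : ℝ} (hR : IsSpread R c t) (hsymm : ∀ x y, R x y → R y x) (hc : 0 < c) (hc1 : c ≤ 1)
    (ht : 0 < t) {ι : Type u} (S : Finset ι) (X : ι → Finset V) (hM : (#S : ℝ) + 1 ≤ M)
    (hX : ∀ i ∈ S, M * t ≤ c ^ #S * #(X i)) :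
    ∃ x : ι → V, (∀ i ∈ S, x i ∈ X i) ∧ ∀ i ∈ S, ∀ j ∈ S, i ≠ j → ¬ R (x i) (x j) := by
  induction S using Finset.induction_on generalizing X with
  | empty => exact ⟨fun _ => Classical.arbitrary V, by simp, by simp⟩
  | insert a S ha ih =>
    rw [card_insert_of_notMem ha] at hM hX
    push_cast at hM
    have hX' : ∀ i ∈ insert a S, M * t ≤ #(X i) := fun i hi =>
      (hX i hi).trans (mul_le_of_le_one_left (by positivity) (pow_le_one₀ hc.le hc1))
    have hM1 : 1 ≤ M := by have : (0 : ℝ) ≤ #S := by positivity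
                           linarith
    have htX : ∀ i ∈ insert a S, t ≤ #(X i) := fun i hi =>
      (le_mul_of_one_le_left ht.le hM1).trans (hX' i hi)
    let bad : ι → Finset V := fun i => {u : V | (#{x ∈ X i | ¬ R u x} : ℝ) < c * #(X i)}
    have hbad : (#(S.biUnion bad) : ℝ) < #(X a) := by
      have h1 : (#(S.biUnion bad) : ℝ) ≤ ∑ i ∈ S, (#(bad i) : ℝ) := by
        exact_mod_cast card_biUnion_le
      have h2 : ∑ i ∈ S, (#(bad i) : ℝ) ≤ #S * t := by
        rw [← nsmul_eq_mul]
        exact sum_le_card_nsmul _ _ _ fun i hi => (hR _ (htX i (mem_insert_of_mem hi))).le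
      have h3 := hX' a (mem_insert_self _ _)
      nlinarith
    obtain ⟨y, hyX, hy⟩ : ∃ y ∈ X a, y ∉ S.biUnion bad :=
      exists_mem_notMem_of_card_lt_card (by exact_mod_cast hbad)
    obtain ⟨x, hx, hxR⟩ := ih (fun i => {z ∈ X i | ¬ R y z}) (by linarith) (by
      intro i hi
      have h1 : c * #(X i) ≤ #{z ∈ X i | ¬ R y z} := by
        by_contra h
        exact hy (mem_biUnion.2 ⟨i, hi, by simpa [bad] using h⟩)
      calc M * t ≤ c ^ (#S + 1) * #(X i) := hX i (mem_insert_of_mem hi)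
        _ = c ^ #S * (c * #(X i)) := by ring
        _ ≤ _ := by gcongr)
    have hne : ∀ i ∈ S, i ≠ a := fun i hi h => ha (h ▸ hi)
    refine ⟨Function.update x a y, ?_, ?_⟩
    · intro i hi
      rcases mem_insert.1 hi with rfl | hi
      · simpa using hyX
      · rw [Function.update_of_ne (hne i hi)]
        exact (mem_filter.1 (hx i hi)).1
    · intro i hi j hj hij
      rcases mem_insert.1 hi with rfl | hi' <;> rcases mem_insert.1 hj with rfl | hj'
      · exact absurd rfl hij
      · rw [Function.update_self, Function.update_of_ne (hne j hj')]
        exact (mem_filter.1 (hx j hj')).2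
      · rw [Function.update_self, Function.update_of_ne (hne i hi')]
        exact fun h => (mem_filter.1 (hx i hi')).2 (hsymm _ _ h)
      · rw [Function.update_of_ne (hne i hi'), Function.update_of_ne (hne j hj')]
        exact hxR i hi' j hj' hij

-- At least half of `U` is unrelated to a proportion `c` of `U`; such a vertex is extended by
-- independent `k`-tuples inside its unrelated set. A positive proportion, rather than mere
-- existence, is needed to outnumber the bad tuples later.
open Finset Classical in
theorem IsSpread.exists_card_independent_ge (k : ℕ) {c : ℝ} (hc : 0 < c) :
    ∃ ε : ℝ, 0 < ε ∧ ∃ L : ℝ, 0 < L ∧ ∀ (V : Type v) [Fintype V] (R : V → V → Prop) (t : ℝ),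
      0 < t → (∀ x y, R x y → R y x) → IsSpread R c t → ∀ U : Finset V, L * t ≤ #U →
      ε * (#U : ℝ) ^ k ≤
        #{f ∈ Fintype.piFinset (fun _ : Fin k => U) | ∀ i j, i ≠ j → ¬ R (f i) (f j)} := by
  induction k with
  | zero =>
    refine ⟨1, one_pos, 1, one_pos, fun V _ R t ht hsymm hR U hU => ?_⟩
    simp
  | succ k ih =>
    obtain ⟨ε, hε, L, hL, h⟩ := ih
    -- The `2` makes the bad vertices at most half of `U`; `L / c` keeps the unrelated sets large
    -- enough for the induction hypothesis.
    refine ⟨c ^ k * ε / 2, by positivity, max 2 (L / c), by positivity,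
      fun V _ R t ht hsymm hR U hU => ?_⟩
    have hU2 : 2 * t ≤ #U := (mul_le_mul_of_nonneg_right (le_max_left _ _) ht.le).trans hU
    have hUL : L * t ≤ c * #U := by
      have := (mul_le_mul_of_nonneg_right (le_max_right _ _) ht.le).trans hU
      rw [div_mul_eq_mul_div, div_le_iff₀ hc] at this
      linarith
    let good : Finset V := {u ∈ U | c * #U ≤ #{x ∈ U | ¬ R u x}}
    have hgood : (#U : ℝ) / 2 ≤ #good := by
      have h1 : U ⊆ good ∪ ({u : V | (#{x ∈ U | ¬ R u x} : ℝ) < c * #U} : Finset V) := by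
        intro u hu
        simp only [good, mem_union, mem_filter, mem_univ, true_and, hu]
        exact le_or_gt _ _
      have h2 : (#U : ℝ) ≤ #good + #{u : V | (#{x ∈ U | ¬ R u x} : ℝ) < c * #U} := by
        exact_mod_cast (card_le_card h1).trans (card_union_le _ _)
      have h3 := hR U (by linarith)
      linarith
    let nbr : V → Finset V := fun u => {x ∈ U | ¬ R u x}
    let ind : Finset V → Finset (Fin k → V) := fun U =>
      {f ∈ Fintype.piFinset (fun _ : Fin k => U) | ∀ i j, i ≠ j → ¬ R (f i) (f j)}
    have hinj : #(good.sigma fun u => ind (nbr u)) ≤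
        #{f ∈ Fintype.piFinset (fun _ : Fin (k + 1) => U) | ∀ i j, i ≠ j → ¬ R (f i) (f j)} := by
      refine card_le_card_of_injOn (fun p => (Fin.cons p.1 p.2 : Fin (k + 1) → V)) ?_ ?_
      · rintro ⟨u, g⟩ hug
        simp only [coe_sigma, Set.mem_sigma_iff, mem_coe, good, ind, nbr, mem_filter,
          Fintype.mem_piFinset] at hug
        obtain ⟨⟨hu, -⟩, hg, hgi⟩ := hug
        simp only [coe_filter, Fintype.mem_piFinset, Set.mem_ofPred_eq]
        refine ⟨Fin.cases hu fun i => (hg i).1, ?_⟩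
        intro i j
        refine Fin.cases ?_ (fun i => ?_) i <;> refine Fin.cases ?_ (fun j => ?_) j
        · simp
        · intro _
          simpa using (hg j).2
        · intro _ h
          exact (hg i).2 (hsymm _ _ (by simpa using h))
        · intro hij
          simpa using hgi i j (by simpa using hij)
      · rintro ⟨u, g⟩ - ⟨u', g'⟩ - h
        have := Fin.cons_injective2 h
        aesop
    rw [card_sigma] at hinj
    have hsum : #good * (ε * (c * #U) ^ k) ≤ ∑ u ∈ good, (#(ind (nbr u)) : ℝ) := by
      rw [← nsmul_eq_mul]
      refine card_nsmul_le_sum _ _ _ fun u hu => ?_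
      have hu' : c * #U ≤ #(nbr u) := (mem_filter.1 hu).2
      refine le_trans ?_ (h V R t ht hsymm hR (nbr u) (hUL.trans hu'))
      gcongr
    calc c ^ k * ε / 2 * (#U : ℝ) ^ (k + 1) = #U / 2 * (ε * (c * #U) ^ k) := by ring
      _ ≤ #good * (ε * (c * #U) ^ k) := by gcongr
      _ ≤ _ := hsum
      _ ≤ _ := by exact_mod_cast hinj

open Finset Classical in
/-- If, for all choices of the values off the range of `e`, at most `N` choices of the values
on the range of `e` give an element of `S`, then `S` has at most `N |U| ^ (|I| - |J|)` elements. -/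
theorem card_mul_pow_le_of_fiber {I J : Type} [Fintype I] [Fintype J] {V : Type v}
    (e : J ↪ I) (U : Finset V) (S : Finset (I → V)) (hS : ∀ f ∈ S, ∀ i, f i ∈ U) (N : ℕ)
    (h : ∀ f₀ ∈ S, ∃ T : Finset (J → V), #T ≤ N ∧
      ∀ f ∈ S, (∀ i, i ∉ Set.range e → f i = f₀ i) → f ∘ e ∈ T) :
    #S * #U ^ Fintype.card J ≤ N * #U ^ Fintype.card I := by
  let r : (I → V) → ({i // i ∉ Set.range e} → V) := fun f i => f i
  have h1 : #S ≤ N * #(Fintype.piFinset fun _ : {i // i ∉ Set.range e} => U) := by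
    refine card_le_mul_card_image_of_maps_to (f := r) (fun f hf => ?_) N fun g hg => ?_
    · exact Fintype.mem_piFinset.2 fun i => hS f hf i
    · rcases Finset.eq_empty_or_nonempty {f ∈ S | r f = g} with h0 | ⟨f₀, hf₀⟩
      · simp [h0]
      · obtain ⟨hf₀S, rfl⟩ := mem_filter.1 hf₀
        obtain ⟨T, hTN, hT⟩ := h f₀ hf₀S
        refine (card_le_card_of_injOn (fun f => f ∘ e) (fun f hf => ?_) ?_).trans hTN
        · obtain ⟨hfS, hfr⟩ := mem_filter.1 hf
          exact hT f hfS fun i hi => congrFun hfr ⟨i, hi⟩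
        intro f hf f' hf' hff
        funext i
        by_cases hi : i ∈ Set.range e
        · obtain ⟨j, rfl⟩ := hi
          exact congrFun hff j
        · exact congrFun ((mem_filter.1 hf).2.trans (mem_filter.1 hf').2.symm) ⟨i, hi⟩
  have hcard : Fintype.card {i // i ∉ Set.range e} + Fintype.card J = Fintype.card I := by
    have h2 : Fintype.card {i // i ∈ Set.range e} = Fintype.card J :=
      (Fintype.card_congr (Equiv.ofInjective e e.injective)).symm
    have h3 := Fintype.card_subtype_compl (fun i => i ∈ Set.range e)
    have h4 := Fintype.card_subtype_le (fun i => i ∈ Set.range e)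
    omega
  simp only [Fintype.card_piFinset, prod_const, card_univ] at h1
  calc #S * #U ^ Fintype.card J
      ≤ N * #U ^ Fintype.card {i // i ∉ Set.range e} * #U ^ Fintype.card J := by gcongr
    _ = _ := by rw [mul_assoc, ← pow_add, hcard]


/-! ### Common neighbourhoods and dependent random choice -/

open Finset Classical in
/-- The common neighbours of the vertices of a tuple. -/
noncomputable def commonNbrs {V : Type v} [Fintype V] (G : SimpleGraph V) {ι : Type*}
    (g : ι → V) : Finset V := {x | ∀ i, G.Adj x (g i)}

theorem mem_commonNbrs {V : Type v} [Fintype V] {G : SimpleGraph V} {ι : Type*} {g : ι → V}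
    {x : V} : x ∈ commonNbrs G g ↔ ∀ i, G.Adj x (g i) := by
  simp [commonNbrs]

open Finset Classical in
theorem sum_card_commonNbrs {V : Type v} [Fintype V] (G : SimpleGraph V) (d : ℕ) :
    ∑ T : Fin d → V, #(commonNbrs G T) = ∑ x, G.degree x ^ d := by
  have := sum_card_bipartiteAbove_eq_sum_card_bipartiteBelow
    (s := (univ : Finset (Fin d → V))) (t := (univ : Finset V))
    (fun T x => ∀ i, G.Adj x (T i))
  refine Eq.trans ?_ (this.trans ?_)
  · refine sum_congr rfl fun T _ => congrArg card ?_
    ext x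
    simp [mem_commonNbrs, mem_bipartiteAbove]
  · refine sum_congr rfl fun x _ => ?_
    have h : bipartiteBelow (fun (T : Fin d → V) x => ∀ i, G.Adj x (T i)) univ x =
        Fintype.piFinset fun _ : Fin d => G.neighborFinset x := by
      ext T
      simp [mem_bipartiteBelow]
    rw [h, Fintype.card_piFinset_const, SimpleGraph.card_neighborFinset_eq_degree]

-- `g` lies in the common neighbourhood of `T` exactly when `T` lies in that of `g`. So a tuple with
-- few common neighbours is counted for few `T`.
open Finset Classical in
theorem sum_card_tuples_commonNbrs {V : Type v} [Fintype V] (G : SimpleGraph V) (d : ℕ)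
    (p : (Fin d → V) → Prop) :
    ∑ T : Fin d → V, #{g ∈ Fintype.piFinset (fun _ : Fin d => commonNbrs G T) | p g} =
      ∑ g : Fin d → V with p g, #(commonNbrs G g) ^ d := by
  have := sum_card_bipartiteAbove_eq_sum_card_bipartiteBelow
    (s := (univ : Finset (Fin d → V))) (t := ({g | p g} : Finset (Fin d → V)))
    (fun T g => ∀ i j, G.Adj (g i) (T j))
  refine Eq.trans ?_ (this.trans ?_)
  · refine sum_congr rfl fun T _ => congrArg card ?_
    ext x
    simp [mem_commonNbrs, mem_bipartiteAbove, and_comm]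
  · refine sum_congr rfl fun g _ => ?_
    have h : bipartiteBelow (fun (T : Fin d → V) g => ∀ i j, G.Adj (g i) (T j)) univ g =
        Fintype.piFinset fun _ : Fin d => commonNbrs G g := by
      ext T
      simp only [mem_bipartiteBelow, mem_univ, true_and, Fintype.mem_piFinset, mem_commonNbrs]
      exact ⟨fun h i j => (h j i).symm, fun h i j => (h j i).symm⟩
    rw [h, Fintype.card_piFinset_const]

open Finset Classical in
/-- Dependent random choice. -/
theorem exists_rich_set {V : Type v} [Fintype V] [Nonempty V] (G : SimpleGraph V) {d : ℕ}
    (hd : 1 ≤ d) {C K L δ t : ℝ} (hK : 0 < K) (hL : 0 < L) (hδ : 0 < δ) (ht : 0 < t)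
    (hC1 : 1 ≤ C) (hC : K ^ d / δ + L ^ d < C)
    (hG : C * t * (Fintype.card V : ℝ) ^ (2 * d - 1) ≤ (∑ x, (G.degree x : ℝ)) ^ d) :
    ∃ U : Finset V, L * t ≤ #U ∧ (∀ u ∈ U, ∃ w, G.Adj u w) ∧
      (#{g ∈ Fintype.piFinset (fun _ : Fin d => U) | (#(commonNbrs G g) : ℝ) < K * t} : ℝ) ≤
        δ * (#U : ℝ) ^ d := by
  by_contra! hcon
  obtain ⟨e, rfl⟩ : ∃ e, d = e + 1 := ⟨d - 1, by omega⟩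
  set d := e + 1 with hd_def
  set n : ℝ := (Fintype.card V : ℝ) with hn
  have hn0 : 0 < n := by simp [hn, Fintype.card_pos]
  let bad : (Fin d → V) → Prop := fun g => (#(commonNbrs G g) : ℝ) < K * t
  have hadj : ∀ T : Fin d → V, ∀ u ∈ commonNbrs G T, ∃ w, G.Adj u w := fun T u hu =>
    ⟨T 0, mem_commonNbrs.1 hu 0⟩
  -- If no `U` works, then no common neighbourhood does: each is either smaller than `L * t` or has
  -- too many poor tuples.
  have h1 : ∀ T : Fin d → V, (#(commonNbrs G T) : ℝ) ^ d <
      #{g ∈ Fintype.piFinset (fun _ : Fin d => commonNbrs G T) | bad g} / δ + (L * t) ^ d := by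
    intro T
    rcases lt_or_ge (#(commonNbrs G T) : ℝ) (L * t) with h | h
    · have : (#(commonNbrs G T) : ℝ) ^ d < (L * t) ^ d := by gcongr
      have h0 : (0 : ℝ) ≤
        #{g ∈ Fintype.piFinset (fun _ : Fin d => commonNbrs G T) | bad g} / δ := by positivity
      linarith
    · have := hcon _ h (hadj T)
      have h2 : (#(commonNbrs G T) : ℝ) ^ d <
          #{g ∈ Fintype.piFinset (fun _ : Fin d => commonNbrs G T) | bad g} / δ := by
        rw [lt_div_iff₀ hδ, mul_comm]
        exact this
      have h0 : 0 < (L * t) ^ d := by positivity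
      linarith
  have hcard : ((#(univ : Finset (Fin d → V)) : ℕ) : ℝ) = n ^ d := by
    simp [hn]
  have h2 : ∑ T : Fin d → V, (#(commonNbrs G T) : ℝ) ^ d <
      n ^ d * ((K * t) ^ d / δ + (L * t) ^ d) := by
    have hbad : (∑ T : Fin d → V,
        (#{g ∈ Fintype.piFinset (fun _ : Fin d => commonNbrs G T) | bad g} : ℝ)) ≤
        n ^ d * (K * t) ^ d := by
      have h3 := sum_card_tuples_commonNbrs G d bad
      have h4 : (∑ T : Fin d → V,
        (#{g ∈ Fintype.piFinset (fun _ : Fin d => commonNbrs G T) | bad g} : ℝ)) =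
          ∑ g : Fin d → V with bad g, (#(commonNbrs G g) : ℝ) ^ d := by exact_mod_cast h3
      rw [h4]
      calc _ ≤ ∑ g : Fin d → V with bad g, (K * t) ^ d := by
            refine sum_le_sum fun g hg => ?_
            have : (#(commonNbrs G g) : ℝ) < K * t := (mem_filter.1 hg).2
            gcongr
        _ ≤ ∑ g : Fin d → V, (K * t) ^ d :=
            sum_le_sum_of_subset_of_nonneg (filter_subset _ _) fun _ _ _ => by positivity
        _ = _ := by rw [sum_const, nsmul_eq_mul, hcard]
    calc _ < ∑ T : Fin d → V,
        ((#{g ∈ Fintype.piFinset (fun _ : Fin d => commonNbrs G T) | bad g} : ℝ) / δ +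
          (L * t) ^ d) := sum_lt_sum_of_nonempty univ_nonempty fun T _ => h1 T
      _ = (∑ T : Fin d → V,
        (#{g ∈ Fintype.piFinset (fun _ : Fin d => commonNbrs G T) | bad g} : ℝ)) / δ +
          n ^ d * (L * t) ^ d := by
            rw [sum_add_distrib, sum_const, nsmul_eq_mul, hcard, sum_div]
      _ ≤ n ^ d * (K * t) ^ d / δ + n ^ d * (L * t) ^ d := by gcongr
      _ = _ := by ring
  have h3 : C * t * n ^ d ≤ ∑ T : Fin d → V, (#(commonNbrs G T) : ℝ) := by
    have h4 : (∑ T : Fin d → V, (#(commonNbrs G T) : ℝ)) = ∑ x, (G.degree x : ℝ) ^ d := by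
      exact_mod_cast sum_card_commonNbrs G d
    have h5 := pow_sum_div_card_le_sum_pow (s := (univ : Finset V))
      (f := fun x => (G.degree x : ℝ)) (fun _ _ => by positivity) e
    rw [h4]
    refine le_trans ?_ h5
    rw [card_univ, le_div_iff₀ (by positivity)]
    refine le_trans (le_of_eq ?_) hG
    rw [show 2 * d - 1 = d + e by omega, pow_add]
    ring
  -- Power means were applied to the degrees and are now applied to the sizes of the common
  -- neighbourhoods; compared with `h2`, this forces `C ^ d < K ^ d / δ + L ^ d`.
  have h6 := pow_sum_div_card_le_sum_pow (s := (univ : Finset (Fin d → V)))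
      (f := fun T => (#(commonNbrs G T) : ℝ)) (fun _ _ => by positivity) e
  rw [hcard, div_le_iff₀ (by positivity)] at h6
  have h7 : (C * t * n ^ d) ^ d ≤ (∑ T : Fin d → V, (#(commonNbrs G T) : ℝ)) ^ d := by gcongr
  have h8 : (C * t * n ^ d) ^ d <
      n ^ d * ((K * t) ^ d / δ + (L * t) ^ d) * (n ^ d) ^ e :=
    (h7.trans h6).trans_lt (by gcongr)
  have h9 : n ^ d * ((K * t) ^ d / δ + (L * t) ^ d) * (n ^ d) ^ e =
      (K ^ d / δ + L ^ d) * (t ^ d * (n ^ d) ^ d) := by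
    rw [mul_pow, mul_pow, hd_def, pow_succ (n ^ (e + 1)) e]
    ring
  have h10 : (C * t * n ^ d) ^ d = C ^ d * (t ^ d * (n ^ d) ^ d) := by
    rw [mul_pow, mul_pow]; ring
  rw [h9, h10] at h8
  have h11 : C ^ d < K ^ d / δ + L ^ d := lt_of_mul_lt_mul_right h8 (by positivity)
  have h12 : C ≤ C ^ d := le_self_pow₀ hC1 (by omega)
  linarith


/-! ### Trimming common neighbourhoods around an independent tuple -/

open Finset Classical in
theorem card_filter_comp_le {V : Type v} {d k : ℕ} (e : Fin d ↪ Fin k) (U : Finset V)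
    (p : (Fin d → V) → Prop) :
    #{f ∈ Fintype.piFinset (fun _ : Fin k => U) | p (f ∘ e)} * #U ^ d ≤
      #{g ∈ Fintype.piFinset (fun _ : Fin d => U) | p g} * #U ^ k := by
  have := card_mul_pow_le_of_fiber e U
    {f ∈ Fintype.piFinset (fun _ : Fin k => U) | p (f ∘ e)}
    (fun f hf => Fintype.mem_piFinset.1 (mem_filter.1 hf).1)
    #{g ∈ Fintype.piFinset (fun _ : Fin d => U) | p g} (fun f₀ _ => ⟨_, le_rfl, fun f hf _ => by
      obtain ⟨hfU, hfp⟩ := mem_filter.1 hf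
      exact mem_filter.2 ⟨Fintype.mem_piFinset.2 fun i => Fintype.mem_piFinset.1 hfU _, hfp⟩⟩)
  simpa using this

-- As `X f` ignores the coordinate `j`, fixing the others fixes the set, and spreadness leaves at
-- most `t` bad values of `f j`.
open Finset Classical in
theorem IsSpread.card_filter_shrink_le {V : Type v} [Fintype V] {R : V → V → Prop} {c t : ℝ}
    (hR : IsSpread R c t) (ht : 0 < t) {k : ℕ} (j : Fin k) (U : Finset V)
    (X : (Fin k → V) → Finset V) (hX : ∀ f f', (∀ i, i ≠ j → f i = f' i) → X f = X f') :
    (#{f ∈ Fintype.piFinset (fun _ : Fin k => U) |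
      t ≤ #(X f) ∧ (#{x ∈ X f | ¬ R (f j) x} : ℝ) < c * #(X f)} : ℝ) * #U ≤ t * (#U : ℝ) ^ k := by
  let e : Unit ↪ Fin k := ⟨fun _ => j, fun _ _ _ => rfl⟩
  have := card_mul_pow_le_of_fiber e U {f ∈ Fintype.piFinset (fun _ : Fin k => U) |
      t ≤ #(X f) ∧ (#{x ∈ X f | ¬ R (f j) x} : ℝ) < c * #(X f)}
    (fun f hf => Fintype.mem_piFinset.1 (mem_filter.1 hf).1) ⌊t⌋₊ (fun f₀ hf₀ => by
      obtain ⟨-, hft, -⟩ := mem_filter.1 hf₀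
      refine ⟨({u : V | (#{x ∈ X f₀ | ¬ R u x} : ℝ) < c * #(X f₀)} : Finset V).image fun u _ => u,
        card_image_le.trans (Nat.le_floor (hR _ hft).le), fun f hf hff₀ => ?_⟩
      have h1 : X f = X f₀ := hX _ _ fun i hi => hff₀ i fun ⟨_, h⟩ => hi h.symm
      have h2 := (mem_filter.1 hf).2.2
      rw [h1] at h2
      exact mem_image.2 ⟨f j, by simpa using h2, rfl⟩)
  simp only [Fintype.card_unit, pow_one, Fintype.card_fin] at this
  calc _ ≤ (⌊t⌋₊ : ℝ) * (#U : ℝ) ^ k := by exact_mod_cast this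
    _ ≤ _ := by gcongr; exact Nat.floor_le ht.le

open Finset Classical in
/-- The common neighbours in `G` of the vertices `f i` with `i` in the range of `e` which are
`R`-unrelated to the first `j` of the other vertices `f i`. -/
noncomputable def trimmedNbrs {V : Type v} [Fintype V] (G : SimpleGraph V) (R : V → V → Prop)
    {d k : ℕ} (e : Fin d ↪ Fin k) (f : Fin k → V) (j : ℕ) : Finset V :=
  {x ∈ commonNbrs G (f ∘ e) | ∀ i : Fin k, i.val < j → i ∉ Set.range e → ¬ R (f i) x}

-- Each index outside the range of `e` costs at most a factor `c`, the others cost nothing. The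
-- condition `1 ≤ c ^ k * K` keeps every intermediate set above the threshold `t` at which `h`
-- applies.
open Finset Classical in
theorem pow_mul_le_card_trimmedNbrs {V : Type v} [Fintype V] {G : SimpleGraph V}
    {R : V → V → Prop} {d k : ℕ} {e : Fin d ↪ Fin k} {f : Fin k → V} {c t K : ℝ} (hc : 0 < c)
    (hc1 : c ≤ 1) (ht : 0 < t) (hK : 1 ≤ c ^ k * K) (h0 : K * t ≤ #(commonNbrs G (f ∘ e)))
    (h : ∀ j : Fin k, j ∉ Set.range e → t ≤ #(trimmedNbrs G R e f j) →
      c * #(trimmedNbrs G R e f j) ≤ #{x ∈ trimmedNbrs G R e f j | ¬ R (f j) x}) (j : ℕ)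
    (hj : j ≤ k) : c ^ j * (K * t) ≤ #(trimmedNbrs G R e f j) := by
  have hK0 : 0 < K := pos_of_mul_pos_right (by linarith) (by positivity : 0 ≤ c ^ k)
  induction j with
  | zero => simpa [trimmedNbrs] using h0
  | succ j ih =>
    have ih := ih (by omega)
    let j' : Fin k := ⟨j, by omega⟩
    by_cases hjr : j' ∈ Set.range e
    · have h1 : trimmedNbrs G R e f (j + 1) = trimmedNbrs G R e f j := by
        ext x
        simp only [trimmedNbrs, mem_filter, and_congr_right_iff]
        intro _
        refine ⟨fun hh i hi => hh i (by omega), fun hh i hi hir => hh i ?_ hir⟩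
        refine lt_of_le_of_ne (by omega) fun hij => hir ?_
        rwa [show i = j' from Fin.ext hij]
      rw [h1]
      refine le_trans ?_ ih
      have : c ^ (j + 1) ≤ c ^ j := pow_le_pow_of_le_one hc.le hc1 (by omega)
      gcongr
    · have h1 : trimmedNbrs G R e f (j + 1) = {x ∈ trimmedNbrs G R e f j | ¬ R (f j') x} := by
        ext x
        simp only [trimmedNbrs, mem_filter, and_assoc, and_congr_right_iff]
        intro _
        refine ⟨fun hh => ⟨fun i hi => hh i (by omega), hh j' (by simp [j']) hjr⟩,
          fun hh i hi hir => ?_⟩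
        rcases Nat.lt_succ_iff_lt_or_eq.1 hi with hi | hi
        · exact hh.1 i hi hir
        · rw [show i = j' from Fin.ext hi]
          exact hh.2
      have h2 : t ≤ #(trimmedNbrs G R e f j) := by
        refine le_trans ?_ ih
        have h3 : c ^ k ≤ c ^ j := pow_le_pow_of_le_one hc.le hc1 (by omega)
        have h4 : c ^ k * K ≤ c ^ j * K := by gcongr
        rw [← mul_assoc]
        exact le_mul_of_one_le_left ht.le (hK.trans h4)
      rw [h1]
      calc c ^ (j + 1) * (K * t) = c * (c ^ j * (K * t)) := by ring
        _ ≤ c * #(trimmedNbrs G R e f j) := by gcongr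
        _ ≤ _ := h j' hjr h2

open Finset Classical in
theorem exists_induced_configuration (W : Type u) [Fintype W] (k : ℕ) {d : ℕ} (hd : 1 ≤ d) {c : ℝ}
    (hc : 0 < c) (hc1 : c ≤ 1) :
    ∃ C : ℝ, 1 ≤ C ∧ ∀ (V : Type v) [Fintype V] [Nonempty V] (R : V → V → Prop) (t : ℝ), 0 < t →
      (∀ x y, R x y → R y x) → IsSpread R c t → ∀ G : SimpleGraph V,
      C * t * (Fintype.card V : ℝ) ^ (2 * d - 1) ≤ (∑ x, (G.degree x : ℝ)) ^ d →
      ∀ e : W → (Fin d ↪ Fin k), ∃ (f : Fin k → V) (x : W → V),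
        (∀ i j, i ≠ j → ¬ R (f i) (f j)) ∧ (∀ i, ∃ w, G.Adj (f i) w) ∧
        (∀ a b, a ≠ b → ¬ R (x a) (x b)) ∧ (∀ a i, G.Adj (x a) (f (e a i))) ∧
        ∀ a i, i ∉ Set.range (e a) → ¬ R (f i) (x a) := by
  obtain ⟨ε, hε, L₀, hL₀, hind⟩ := IsSpread.exists_card_independent_ge.{v} k hc
  set w : ℝ := (Fintype.card W : ℝ) with hw
  have hw0 : 0 ≤ w := by positivity
  -- In `K`, `c ^ k` pays for trimming and the rest for the transversal. With `δ`, poor tuples fill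
  -- less than `ε / 2` of all tuples; with `L`, failures of trimming fill at most `ε / 2`.
  set K : ℝ := (w + 1) / c ^ (k + Fintype.card W) with hK
  set δ : ℝ := ε / (2 * (w + 1)) with hδ
  set L : ℝ := max L₀ (2 * (w + 1) * (k + 1) / ε) with hL
  have hLpos : 0 < L := hL₀.trans_le (le_max_left _ _)
  have hKpos : 0 < K := by positivity
  have hδpos : 0 < δ := by positivity
  have hKc : c ^ k * K * c ^ Fintype.card W = w + 1 := by
    rw [hK, pow_add]
    field_simp
  have hKc1 : 1 ≤ c ^ k * K := by
    have h1 : c ^ Fintype.card W ≤ 1 := pow_le_one₀ hc.le hc1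
    have h2 : c ^ k * K * c ^ Fintype.card W ≤ c ^ k * K := mul_le_of_le_one_right (by positivity) h1
    linarith
  refine ⟨K ^ d / δ + L ^ d + 1, by have : 0 ≤ K ^ d / δ + L ^ d := by positivity
                                    linarith, ?_⟩
  intro V _ _ R t ht hsymm hR G hG e
  obtain ⟨U, hU, hUG, hUbad⟩ := exists_rich_set G hd hKpos hLpos hδpos ht
    (by have : 0 ≤ K ^ d / δ + L ^ d := by positivity
        linarith) (lt_add_one _) hG
  have hU0 : (0 : ℝ) < #U := lt_of_lt_of_le (by positivity) hU
  let ind : Finset (Fin k → V) :=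
    {f ∈ Fintype.piFinset (fun _ : Fin k => U) | ∀ i j, i ≠ j → ¬ R (f i) (f j)}
  let poor : W → Finset (Fin k → V) := fun a =>
    {f ∈ Fintype.piFinset (fun _ : Fin k => U) | (#(commonNbrs G (f ∘ e a)) : ℝ) < K * t}
  let fail : W × Fin k → Finset (Fin k → V) := fun q =>
    {f ∈ Fintype.piFinset (fun _ : Fin k => U) | q.2 ∉ Set.range (e q.1) ∧
      t ≤ #(trimmedNbrs G R (e q.1) f q.2) ∧
      (#{x ∈ trimmedNbrs G R (e q.1) f q.2 | ¬ R (f q.2) x} : ℝ) <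
        c * #(trimmedNbrs G R (e q.1) f q.2)}
  have hpoor : ∀ a, (#(poor a) : ℝ) ≤ δ * (#U : ℝ) ^ k := by
    intro a
    have h1 := card_filter_comp_le (e a) U fun g => (#(commonNbrs G g) : ℝ) < K * t
    have h2 : (#(poor a) : ℝ) * (#U : ℝ) ^ d ≤ δ * (#U : ℝ) ^ d * (#U : ℝ) ^ k :=
      le_trans (by exact_mod_cast h1) (mul_le_mul_of_nonneg_right hUbad (by positivity))
    refine le_of_mul_le_mul_right ?_ (by positivity : (0 : ℝ) < (#U : ℝ) ^ d)
    linarith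
  have hfail : ∀ q, (#(fail q) : ℝ) ≤ (#U : ℝ) ^ k / L := by
    rintro ⟨a, j⟩
    by_cases hj : j ∈ Set.range (e a)
    · have : fail (a, j) = ∅ := by
        simp only [fail, filter_eq_empty_iff]
        exact fun f _ h => h.1 hj
      rw [this]
      simp only [card_empty, Nat.cast_zero]
      positivity
    -- Trimming in order matters: the set before step `j` involves only earlier indices and the
    -- range of `e a`, hence not `f j`.
    · have h1 := hR.card_filter_shrink_le ht j U (fun f => trimmedNbrs G R (e a) f j) (by
        intro f f' hff
        have h2 : f ∘ e a = f' ∘ e a := funext fun i => hff _ fun h => hj ⟨i, h⟩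
        ext x
        simp only [trimmedNbrs, h2, mem_filter, and_congr_right_iff]
        intro _
        refine forall_congr' fun i => forall_congr' fun hi => ?_
        rw [hff i (fun h => by simp [h] at hi)])
      have h3 : fail (a, j) ⊆ {f ∈ Fintype.piFinset (fun _ : Fin k => U) |
          t ≤ #(trimmedNbrs G R (e a) f j) ∧
          (#{x ∈ trimmedNbrs G R (e a) f j | ¬ R (f j) x} : ℝ) <
            c * #(trimmedNbrs G R (e a) f j)} :=
        monotone_filter_right _ fun f _ h => h.2
      have h4 : (#(fail (a, j)) : ℝ) * #U ≤ t * (#U : ℝ) ^ k :=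
        le_trans (mul_le_mul_of_nonneg_right (by exact_mod_cast card_le_card h3) hU0.le) h1
      rw [le_div_iff₀ hLpos]
      refine le_of_mul_le_mul_right ?_ ht
      calc (#(fail (a, j)) : ℝ) * L * t = #(fail (a, j)) * (L * t) := by ring
        _ ≤ #(fail (a, j)) * #U := by gcongr
        _ ≤ _ := by linarith
  have htotal : (#(univ.biUnion poor ∪ univ.biUnion fail) : ℝ) < #ind := by
    have h1 : (#(univ.biUnion poor) : ℝ) ≤ w * (δ * (#U : ℝ) ^ k) := by
      calc (#(univ.biUnion poor) : ℝ) ≤ ∑ a, (#(poor a) : ℝ) := by exact_mod_cast card_biUnion_le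
        _ ≤ _ := by
          have := sum_le_card_nsmul univ (fun a => (#(poor a) : ℝ)) _ fun a _ => hpoor a
          rwa [nsmul_eq_mul, card_univ] at this
    have h2 : (#(univ.biUnion fail) : ℝ) ≤ w * k * ((#U : ℝ) ^ k / L) := by
      calc (#(univ.biUnion fail) : ℝ) ≤ ∑ a, (#(fail a) : ℝ) := by exact_mod_cast card_biUnion_le
        _ ≤ _ := by
          have := sum_le_card_nsmul univ (fun a => (#(fail a) : ℝ)) _ fun a _ => hfail a
          rwa [nsmul_eq_mul, card_univ, Fintype.card_prod, Fintype.card_fin, Nat.cast_mul] at this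
    have h3 : (#(univ.biUnion poor ∪ univ.biUnion fail) : ℝ) ≤
        #(univ.biUnion poor) + #(univ.biUnion fail) := by exact_mod_cast card_union_le _ _
    have h4 : ε * (#U : ℝ) ^ k ≤ #ind := hind V R t ht hsymm hR U
      ((mul_le_mul_of_nonneg_right (le_max_left _ _) ht.le).trans hU)
    have h5 : w * δ < ε / 2 := by
      rw [hδ, ← mul_div_assoc, div_lt_div_iff₀ (by positivity) (by positivity)]
      nlinarith
    have h6 : w * k / L ≤ ε / 2 := by
      have h7 : 2 * (w + 1) * (k + 1) / ε ≤ L := le_max_right _ _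
      rw [div_le_iff₀ hε] at h7
      rw [div_le_div_iff₀ hLpos (by positivity)]
      have : (0 : ℝ) ≤ k := by positivity
      nlinarith
    have h8 : w * (δ * (#U : ℝ) ^ k) + w * k * ((#U : ℝ) ^ k / L) =
        (w * δ + w * k / L) * (#U : ℝ) ^ k := by ring
    have h9 : (w * δ + w * k / L) * (#U : ℝ) ^ k < ε * (#U : ℝ) ^ k :=
      mul_lt_mul_of_pos_right (by linarith) (by positivity)
    linarith
  obtain ⟨f, hf, hf'⟩ := exists_mem_notMem_of_card_lt_card (by exact_mod_cast htotal)
  obtain ⟨hfU, hfind⟩ := mem_filter.1 hf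
  simp only [mem_union, mem_biUnion, mem_univ, true_and, not_or, not_exists] at hf'
  have hX : ∀ a, c ^ k * (K * t) ≤ #(trimmedNbrs G R (e a) f k) := fun a => by
    refine pow_mul_le_card_trimmedNbrs hc hc1 ht hKc1 ?_ ?_ k le_rfl
    · by_contra! h
      exact hf'.1 a (mem_filter.2 ⟨hfU, h⟩)
    · intro j hj htj
      by_contra! h
      exact hf'.2 (a, j) (mem_filter.2 ⟨hfU, hj, htj, h⟩)
  obtain ⟨x, hx, hxR⟩ := hR.exists_transversal hsymm hc hc1 ht (univ : Finset W)
    (fun a => trimmedNbrs G R (e a) f k) (M := w + 1) (by rw [card_univ]) (fun a _ => by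
      rw [card_univ]
      calc (w + 1) * t = c ^ Fintype.card W * (c ^ k * (K * t)) := by rw [← hKc]; ring
        _ ≤ _ := by gcongr; exact hX a)
  refine ⟨f, x, hfind, fun i => hUG _ (Fintype.mem_piFinset.1 hfU i),
    fun a b hab => hxR a (mem_univ _) b (mem_univ _) hab, fun a i => ?_, fun a i hi => ?_⟩
  · exact mem_commonNbrs.1 (mem_filter.1 (hx a (mem_univ _))).1 i
  · exact (mem_filter.1 (hx a (mem_univ _))).2 i i.2 hi


/-! ### From sparsity to induced copies of `H` -/

theorem IsSparse.mono_left {V : Type u} {Γ : SimpleGraph V} {c c' t : ℝ} (h : IsSparse Γ c t)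
    (hc : c' ≤ c) : IsSparse Γ c' t := by
  intro A B hA hB
  refine (h A B hA hB).trans ?_
  gcongr

-- If `t` vertices were bad for `X`, the pairs between them and `X` would be denser than `1 - c`.
-- Including equality in the relation makes unrelated vertices distinct; it costs one element of
-- `X`, at most `c / 2 * #X` once `#X ≥ 2 / c`.
open Finset Classical in
theorem IsSparse.isSpread {V : Type v} [Fintype V] {Γ : SimpleGraph V} {c t : ℝ}
    (h : IsSparse Γ c t) (hc : 0 < c) (ht : 0 < t) :
    IsSpread (fun x y => x = y ∨ Γ.Adj x y) (c / 2) (max t (2 / c)) := by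
  intro X hX
  refine lt_of_lt_of_le ?_ (le_max_left _ _)
  have hXt : t ≤ #X := (le_max_left _ _).trans hX
  have hXc : 2 ≤ c * #X := by
    have := (le_max_right _ _).trans hX
    rwa [div_le_iff₀' hc] at this
  let Y : Finset V := {u : V | (#{x ∈ X | ¬ (u = x ∨ Γ.Adj u x)} : ℝ) < c / 2 * #X}
  suffices hlt : (#Y : ℝ) < t by
    refine lt_of_eq_of_lt (congrArg _ (congrArg card ?_)) hlt
    ext u
    simp [Y]
  by_contra hcon
  have hYt : t ≤ #Y := not_lt.1 hcon
  have hY0 : (0 : ℝ) < #Y := ht.trans_le hYt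
  have hYne : Y.Nonempty := card_pos.1 (by exact_mod_cast hY0)
  have hpt : ∀ u ∈ Y, (#X : ℝ) < #{x ∈ X | Γ.Adj u x} + 1 + c / 2 * #X := by
    intro u hu
    have h1 := (mem_filter.1 hu).2
    have h2 : X ⊆ ({x ∈ X | Γ.Adj u x} ∪ {u}) ∪ {x ∈ X | ¬ (u = x ∨ Γ.Adj u x)} := by
      intro x hx
      simp only [mem_union, mem_filter, mem_singleton, hx, true_and]
      tauto
    have h3 : (#X : ℝ) ≤ #{x ∈ X | Γ.Adj u x} + 1 + #{x ∈ X | ¬ (u = x ∨ Γ.Adj u x)} := by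
      have h4 := (card_le_card h2).trans (card_union_le _ _)
      have h5 := card_union_le {x ∈ X | Γ.Adj u x} {u}
      rw [card_singleton] at h5
      exact_mod_cast h4.trans (Nat.add_le_add_right h5 _)
    linarith
  have hsum : ∑ u ∈ Y, (#{x ∈ X | Γ.Adj u x} : ℝ) = #(Γ.interedges Y X) := by
    have : #(Γ.interedges Y X) = ∑ u ∈ Y, #{x ∈ X | Γ.Adj u x} := by
      rw [← card_sigma]
      refine card_bij' (fun p _ => ⟨p.1, p.2⟩) (fun p _ => (p.1, p.2)) ?_ ?_ ?_ ?_
      · rintro ⟨a, b⟩ hab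
        rw [SimpleGraph.mem_interedges_iff] at hab
        simp [hab]
      · rintro ⟨a, b⟩ hab
        simp only [mem_sigma, mem_filter] at hab
        rw [SimpleGraph.mem_interedges_iff]
        exact hab
      · simp
      · simp
    rw [this]
    push_cast
    rfl
  have h1 := sum_lt_sum_of_nonempty hYne hpt
  rw [sum_add_distrib, sum_add_distrib, hsum, sum_const, sum_const, sum_const] at h1
  simp only [nsmul_eq_mul] at h1
  have h2 := h Y X hYt hXt
  have hY0 : (0 : ℝ) < #Y := by exact_mod_cast card_pos.2 hYne
  have h3 : (#Y : ℝ) * 2 ≤ #Y * (c * #X) := by gcongr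
  nlinarith

/-- A subset of size at most `m` of the domain of an embedding can be covered by exactly `m` values
outside of which it meets no other point of the domain. -/
theorem exists_embedding_mem_range_iff {W : Type u} [Finite W] {d k : ℕ} (hk : Nat.card W + d ≤ k)
    (b : W ↪ Fin k) (S : Set W) (hS : S.ncard ≤ d) :
    ∃ e : Fin d ↪ Fin k, ∀ w, b w ∈ Set.range e ↔ w ∈ S := by
  classical
  have := Fintype.ofFinite W
  rw [Nat.card_eq_fintype_card] at hk
  have hSc : S.toFinset.card ≤ d := by rwa [← Set.ncard_eq_toFinset_card']
  obtain ⟨D, hD, hDc⟩ := Finset.exists_subset_card_eq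
    (s := (Finset.univ.map b)ᶜ) (n := d - S.toFinset.card) (by
      rw [Finset.card_compl, Finset.card_map, Finset.card_univ, Fintype.card_fin]
      omega)
  have hdisj : Disjoint (S.toFinset.map b) D := by
    refine Finset.disjoint_left.2 fun i hi hiD => ?_
    refine Finset.mem_compl.1 (hD hiD) (Finset.map_subset_map.2 (Finset.subset_univ _) hi)
  have hcard : (S.toFinset.map b ∪ D).card = d := by
    rw [Finset.card_union_of_disjoint hdisj, Finset.card_map, hDc]
    omega
  refine ⟨((S.toFinset.map b ∪ D).orderEmbOfFin hcard).toEmbedding, fun w => ?_⟩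
  simp only [RelEmbedding.coe_toEmbedding, Finset.range_orderEmbOfFin, Finset.mem_coe,
    Finset.mem_union, Finset.mem_map' , Set.mem_toFinset, or_iff_left_iff_imp]
  intro hw
  exact absurd (Finset.mem_map_of_mem b (Finset.mem_univ w)) (Finset.mem_compl.1 (hD hw))

/-- The part `B` is placed on entries of `f`, and `a ∈ A` on `x a`, with `e a` covering the
neighbours of `a` and no other vertex of `H`. The assumption `1 ≤ t` lets the threshold `max t (2 /
c')` be absorbed into the constant. -/
theorem exists_const_hasCopyInducedIn {W : Type u} [Finite W] (H : SimpleGraph W) {c : ℝ}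
    (hc : 0 < c) {d : ℕ} (hd : 1 ≤ d) (hH : IsBipartiteDegreeLE H d) :
    ∃ C : ℝ, 1 ≤ C ∧ ∀ (V : Type v) [Finite V] [Nonempty V] (Γ : SimpleGraph V) (t : ℝ), 1 ≤ t →
      IsSparse Γ c t → ∀ G : Γ.Subgraph,
      C * t * (Nat.card V : ℝ) ^ (2 * d - 1) ≤ (G.edgeSet.ncard : ℝ) ^ d →
      HasCopyInducedIn H Γ G := by
  classical
  have := Fintype.ofFinite W
  obtain ⟨A, B, hAB, hABu, hdeg⟩ := hH
  set c' := min c 1 with hc'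
  have hc'0 : 0 < c' := lt_min hc one_pos
  have hc'1 : c' ≤ 1 := min_le_right _ _
  -- The `d` spare indices pad every neighbourhood to exactly `d` elements without touching the
  -- copy.
  let k := Nat.card W + d
  obtain ⟨b⟩ : Nonempty (W ↪ Fin k) := by
    refine Function.Embedding.nonempty_of_card_le ?_
    simp [k]
  have he : ∀ a, ∃ e : Fin d ↪ Fin k, a ∈ A → ∀ w, b w ∈ Set.range e ↔ H.Adj a w := by
    intro a
    by_cases ha : a ∈ A
    · obtain ⟨e, he⟩ := exists_embedding_mem_range_iff le_rfl b (H.neighborSet a) (hdeg a ha)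
      exact ⟨e, fun _ => he⟩
    · obtain ⟨e, -⟩ := exists_embedding_mem_range_iff le_rfl b ∅ (by simp)
      exact ⟨e, fun h => absurd h ha⟩
  choose e he using he
  obtain ⟨C, hC1, hC⟩ := exists_induced_configuration.{u, v} W k hd (c := c' / 2)
    (by positivity) (by linarith)
  refine ⟨C * (1 + 2 / c'), by
    have : 0 ≤ 2 / c' := by positivity
    nlinarith, ?_⟩
  intro V _ _ Γ t ht hΓ G hG
  have := Fintype.ofFinite V
  have hspread := (hΓ.mono_left (min_le_left c 1)).isSpread hc'0 (by linarith)
  obtain ⟨f, x, hff, hfG, hxx, hxf, hxf'⟩ := hC V _ _ (lt_max_of_lt_left (by linarith))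
    (fun x y h => h.imp Eq.symm SimpleGraph.Adj.symm) hspread G.spanningCoe (by
      rw [Nat.card_eq_fintype_card] at hG
      have h1 : max t (2 / c') ≤ (1 + 2 / c') * t := by
        have : 0 ≤ 2 / c' := by positivity
        refine max_le ?_ ?_ <;> nlinarith
      have h2 : (G.edgeSet.ncard : ℝ) ≤ ∑ x, (G.spanningCoe.degree x : ℝ) := by
        have h3 := G.spanningCoe.sum_degrees_eq_twice_card_edges
        have h4 : G.edgeSet.ncard = G.spanningCoe.edgeFinset.card := by
          rw [← SimpleGraph.Subgraph.edgeSet_spanningCoe, ← SimpleGraph.coe_edgeFinset,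
            Set.ncard_coe_finset]
        have h5 : G.edgeSet.ncard ≤ ∑ x, G.spanningCoe.degree x := by omega
        exact_mod_cast h5
      calc C * max t (2 / c') * (Fintype.card V : ℝ) ^ (2 * d - 1)
          ≤ C * ((1 + 2 / c') * t) * (Fintype.card V : ℝ) ^ (2 * d - 1) := by gcongr
        _ = C * (1 + 2 / c') * t * (Fintype.card V : ℝ) ^ (2 * d - 1) := by ring
        _ ≤ (G.edgeSet.ncard : ℝ) ^ d := hG
        _ ≤ _ := by gcongr) e
  have hdisj := hAB.disjoint
  have hBA : ∀ w, w ∉ B → w ∈ A := fun w hw =>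
    ((Set.mem_union _ _ _).1 (hABu ▸ Set.mem_univ w)).resolve_right hw
  have hAB' : ∀ w, w ∈ A → w ∉ B := fun w hw hw' => Set.disjoint_left.1 hdisj hw hw'
  let φ : W → V := fun w => if w ∈ B then f (b w) else x w
  have hφB : ∀ w, w ∈ B → φ w = f (b w) := fun w hw => if_pos hw
  have hφA : ∀ w, w ∉ B → φ w = x w := fun w hw => if_neg hw
  have hBB : ∀ w w', w ∈ B → w' ∈ B → ¬ H.Adj w w' := by
    intro w w' hw hw' h
    rcases hAB.mem_of_adj h with h | h
    · exact hAB' _ h.1 hw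
    · exact hAB' _ h.2 hw'
  have hAA : ∀ w w', w ∉ B → w' ∉ B → ¬ H.Adj w w' := by
    intro w w' hw hw' h
    rcases hAB.mem_of_adj h with h | h
    · exact hw' h.2
    · exact hw h.1
  have hmixed : ∀ w w', w ∉ B → w' ∈ B → H.Adj w w' → G.Adj (x w) (f (b w')) := by
    intro w w' hw _ h
    obtain ⟨i, hi⟩ := (he w (hBA w hw) w').2 h
    have := hxf w i
    rw [hi] at this
    exact this
  have hmixed' : ∀ w w', w ∉ B → ¬ H.Adj w w' → ¬ (f (b w') = x w ∨ Γ.Adj (f (b w')) (x w)) :=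
    fun w w' hw h => hxf' w (b w') fun hr => h ((he w (hBA w hw) w').1 hr)
  have hadj : ∀ w w', H.Adj w w' → G.Adj (φ w) (φ w') := by
    intro w w' h
    by_cases hw : w ∈ B <;> by_cases hw' : w' ∈ B
    · exact absurd h (hBB w w' hw hw')
    · rw [hφB w hw, hφA w' hw']
      exact (hmixed w' w hw' hw h.symm).symm
    · rw [hφA w hw, hφB w' hw']
      exact hmixed w w' hw hw' h
    · exact absurd h (hAA w w' hw hw')
  have hnadj : ∀ w w', w ≠ w' → ¬ H.Adj w w' → ¬ (φ w = φ w' ∨ Γ.Adj (φ w) (φ w')) := by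
    intro w w' hne h
    by_cases hw : w ∈ B <;> by_cases hw' : w' ∈ B
    · rw [hφB w hw, hφB w' hw']
      exact hff _ _ fun hb => hne (b.injective hb)
    · rw [hφB w hw, hφA w' hw']
      exact hmixed' w' w hw' fun h' => h h'.symm
    · rw [hφA w hw, hφB w' hw', eq_comm, SimpleGraph.adj_comm]
      exact hmixed' w w' hw h
    · rw [hφA w hw, hφA w' hw']
      exact hxx w w' hne
  refine ⟨⟨⟨φ, fun w w' hww => ?_⟩, fun {w w'} => ⟨fun h => ?_, fun h => (hadj w w' h).adj_sub⟩⟩,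
    fun w => ?_, hadj⟩
  · by_contra hne
    by_cases h : H.Adj w w'
    · exact (hadj w w' h).adj_sub.ne hww
    · exact hnadj w w' hne h (Or.inl hww)
  · by_contra h'
    have hne : w ≠ w' := fun hww => by
      subst hww
      exact Γ.loopless.irrefl _ h
    exact hnadj w w' hne h' (Or.inr h)
  · by_cases hw : w ∈ B
    · obtain ⟨v, hv⟩ := hfG (b w)
      change φ w ∈ G.verts
      rw [hφB w hw]
      exact G.edge_vert hv
    · change φ w ∈ G.verts
      rw [hφA w hw]
      exact G.edge_vert (hxf w ⟨0, hd⟩)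

/-! ### A constant independent of `d` -/

theorem IsBipartiteDegreeLE.min_card {W : Type u} [Finite W] {H : SimpleGraph W} {d : ℕ}
    (h : IsBipartiteDegreeLE H d) : IsBipartiteDegreeLE H (min d (Nat.card W + 1)) := by
  obtain ⟨A, B, hAB, hABu, hdeg⟩ := h
  exact ⟨A, B, hAB, hABu, fun a ha => le_min (hdeg a ha)
    ((Set.ncard_le_card _).trans (Nat.le_succ _))⟩

theorem IsSparse.one_le_of_adj {V : Type v} {Γ : SimpleGraph V} {c t : ℝ} (h : IsSparse Γ c t)
    (hc : 0 < c) {a b : V} (hab : Γ.Adj a b) : 1 ≤ t := by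
  classical
  by_contra! ht
  have h1 := h {a} {b} (by simpa using ht.le) (by simpa using ht.le)
  have h2 : (a, b) ∈ Γ.interedges {a} {b} := by
    rw [SimpleGraph.mem_interedges_iff]
    simp [hab]
  have h3 : 1 ≤ (Γ.interedges {a} {b}).card := Finset.card_pos.2 ⟨_, h2⟩
  have h4 : (1 : ℝ) ≤ (Γ.interedges {a} {b}).card := by exact_mod_cast h3
  simp only [Finset.card_singleton, Nat.cast_one, mul_one] at h1
  have h5 : (1 : ℝ) ≤ 1 - c := h4.trans (by convert h1)
  linarith

theorem ncard_edgeSet_lt_sq {V : Type v} [Finite V] [Nonempty V] {Γ : SimpleGraph V}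
    (G : Γ.Subgraph) : G.edgeSet.ncard < Nat.card V ^ 2 := by
  classical
  have := Fintype.ofFinite V
  have h1 : G.edgeSet.ncard = G.spanningCoe.edgeFinset.card := by
    rw [← SimpleGraph.Subgraph.edgeSet_spanningCoe, ← SimpleGraph.coe_edgeFinset,
            Set.ncard_coe_finset]
  have h2 := G.spanningCoe.card_edgeFinset_le_card_choose_two
  have h3 : 0 < Fintype.card V := Fintype.card_pos
  rw [h1, Nat.card_eq_fintype_card]
  refine h2.trans_lt ?_
  rw [Nat.choose_two_right]
  have h4 : Fintype.card V * (Fintype.card V - 1) / 2 ≤ Fintype.card V * (Fintype.card V - 1) :=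
    Nat.div_le_self _ _
  have h5 : Fintype.card V * (Fintype.card V - 1) < Fintype.card V * Fintype.card V :=
    Nat.mul_lt_mul_of_pos_left (by omega) h3
  nlinarith

theorem rpow_mul_rpow_eq {t n : ℝ} (ht : 0 < t) (hn : 0 < n) (s : ℝ) :
    t ^ s * n ^ (2 - s) = n ^ 2 * (t / n) ^ s := by
  rw [Real.rpow_sub hn, Real.div_rpow ht.le hn.le, Real.rpow_two]
  ring

/-- Degrees in `H` are at most `|W|`, so `d` can be cut down to `|W| + 1`, and the sum of finitely
many constants serves all `d`. -/
theorem exists_uniform_const_hasCopyInducedIn {W : Type u} [Finite W] (H : SimpleGraph W) {c : ℝ}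
    (hc : 0 < c) :
    ∃ C : ℝ, 0 < C ∧ ∀ d : ℕ, 1 ≤ d → IsBipartiteDegreeLE H d →
      ∀ (V : Type v) [Finite V] [Nonempty V] (Γ : SimpleGraph V) (t : ℝ), 0 < t →
        IsSparse Γ c t → ∀ G : Γ.Subgraph,
          C * t ^ (1 / (d : ℝ)) * (Nat.card V : ℝ) ^ (2 - 1 / (d : ℝ)) ≤ (G.edgeSet.ncard : ℝ) →
          HasCopyInducedIn H Γ G := by
  classical
  have hex : ∀ d : ℕ, ∃ C : ℝ, 1 ≤ C ∧ (1 ≤ d → IsBipartiteDegreeLE H d →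
      ∀ (V : Type v) [Finite V] [Nonempty V] (Γ : SimpleGraph V) (t : ℝ), 1 ≤ t →
      IsSparse Γ c t → ∀ G : Γ.Subgraph,
      C * t * (Nat.card V : ℝ) ^ (2 * d - 1) ≤ (G.edgeSet.ncard : ℝ) ^ d →
      HasCopyInducedIn H Γ G) := by
    intro d
    by_cases hd : 1 ≤ d ∧ IsBipartiteDegreeLE H d
    · obtain ⟨C, hC, h⟩ := exists_const_hasCopyInducedIn.{u, v} H hc hd.1 hd.2
      exact ⟨C, hC, fun _ _ => h⟩
    · exact ⟨1, le_rfl, fun h1 h2 => absurd ⟨h1, h2⟩ hd⟩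
  choose C hC1 hC using hex
  let m := Nat.card W + 1
  have hCle : ∀ d ≤ m, C d ≤ ∑ i ∈ Finset.range (m + 1), C i := fun d hd =>
    Finset.single_le_sum (f := C) (fun i _ => by linarith [hC1 i])
      (Finset.mem_range.2 (by omega))
  have hS1 : 1 ≤ ∑ i ∈ Finset.range (m + 1), C i := (hC1 0).trans (hCle 0 (by omega))
  refine ⟨∑ i ∈ Finset.range (m + 1), C i, by linarith, ?_⟩
  intro d hd hH V _ _ Γ t ht hΓ G hG
  set S := ∑ i ∈ Finset.range (m + 1), C i with hS
  set n : ℝ := (Nat.card V : ℝ) with hn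
  have hn0 : 0 < n := by simp [hn, Nat.card_pos]
  rw [mul_assoc, rpow_mul_rpow_eq ht hn0] at hG
  have hpos : (0 : ℝ) < G.edgeSet.ncard := lt_of_lt_of_le (by positivity) hG
  have ht1 : 1 ≤ t := by
    obtain ⟨z, hz⟩ := Set.nonempty_of_ncard_ne_zero (s := G.edgeSet)
      (by exact_mod_cast hpos.ne')
    induction z with
    | _ a b => exact hΓ.one_le_of_adj hc (SimpleGraph.Subgraph.mem_edgeSet.1 hz).adj_sub
  -- Otherwise `G` would have at least `n ^ 2` edges. With base `t / n ≤ 1`, replacing `d` by the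
  -- smaller `d'` only weakens the edge condition.
  have htn : t / n ≤ 1 := by
    by_contra! h
    have h1 : (1 : ℝ) ≤ (t / n) ^ (1 / (d : ℝ)) := Real.one_le_rpow h.le (by positivity)
    have h2 : (G.edgeSet.ncard : ℝ) < n ^ 2 := by
      rw [hn]
      exact_mod_cast ncard_edgeSet_lt_sq G
    have h3 : n ^ 2 ≤ S * (n ^ 2 * (t / n) ^ (1 / (d : ℝ))) := by
      have h4 : n ^ 2 ≤ n ^ 2 * (t / n) ^ (1 / (d : ℝ)) :=
        le_mul_of_one_le_right (by positivity) h1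
      exact h4.trans (le_mul_of_one_le_left (by positivity) hS1)
    linarith
  set d' := min d m with hd'
  have hd'1 : 1 ≤ d' := le_min hd (by omega)
  refine hC d' hd'1 hH.min_card V Γ t ht1 hΓ G ?_
  have h1 : n ^ 2 * (t / n) ^ (1 / (d' : ℝ)) ≤ n ^ 2 * (t / n) ^ (1 / (d : ℝ)) := by
    refine mul_le_mul_of_nonneg_left ?_ (by positivity)
    refine Real.rpow_le_rpow_of_exponent_ge (by positivity) htn ?_
    refine one_div_le_one_div_of_le (by exact_mod_cast hd'1) ?_
    exact_mod_cast min_le_left _ _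
  have h2 : S * (n ^ 2 * (t / n) ^ (1 / (d' : ℝ))) ≤ G.edgeSet.ncard :=
    (mul_le_mul_of_nonneg_left h1 (by linarith)).trans hG
  have h3 : (S * (n ^ 2 * (t / n) ^ (1 / (d' : ℝ)))) ^ d' = S ^ d' * t * n ^ (2 * d' - 1) := by
    rw [mul_pow, mul_pow, one_div, Real.rpow_inv_natCast_pow (by positivity) (by omega),
      ← pow_mul]
    have h4 : n ^ (2 * d') = n ^ (2 * d' - 1) * n := by
      rw [← pow_succ]
      congr 1
      omega
    rw [h4]
    field_simp
  calc C d' * t * n ^ (2 * d' - 1) ≤ S ^ d' * t * n ^ (2 * d' - 1) := by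
        have h5 : C d' ≤ S ^ d' := (hCle d' (min_le_right _ _)).trans
          (le_self_pow₀ hS1 (by omega))
        gcongr
    _ = (S * (n ^ 2 * (t / n) ^ (1 / (d' : ℝ)))) ^ d' := h3.symm
    _ ≤ _ := by gcongr


/-! ### Sparsity of the random graph -/

open MeasureTheory ProbabilityTheory Finset Classical in
/-- A random set of density `p` rarely misses few elements of a given set `E`. -/
theorem setBernoulli_real_miss_few_le {ι : Type u} [Countable ι] (p : unitInterval)
    (E u : Finset ι) (hEu : E ⊆ u) {r : ℝ} {N : ℕ} (hr : 0 < r) (hr1 : r ≤ 1)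
    (hrp : r ^ 2 = (1 + (p : ℝ)) / 2) (hN : r ^ N ≤ 1 / 2) :
    (setBernoulli (u : Set ι) p).real {s | N * #{e ∈ E | e ∉ s} ≤ #E} ≤ r ^ #E := by
  let S : Set (Set ι) := {s | N * #{e ∈ E | e ∉ s} ≤ #E}
  let 𝒯 : Finset (Finset ι) := {T ∈ u.powerset | N * #{e ∈ E | e ∉ T} ≤ #E}
  have hp0 : 0 ≤ (p : ℝ) := p.2.1
  have hp1 : 0 ≤ 1 - (p : ℝ) := by linarith [p.2.2]
  have h1 : (setBernoulli (u : Set ι) p).real S ≤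
      ∑ T ∈ 𝒯, (p : ℝ) ^ #T * (1 - p : ℝ) ^ #(u \ T) := by
    have h2 : (setBernoulli (u : Set ι) p).real S =
        (setBernoulli (u : Set ι) p).real {s ∈ S | s ⊆ u} := by
      rw [measureReal_def, measureReal_def, setBernoulli_apply_eq_apply_subsets]
    have h3 : {s ∈ S | s ⊆ u} ⊆ ⋃ T ∈ 𝒯, ({(T : Set ι)} : Set (Set ι)) := by
      rintro s ⟨hsS, hsu⟩
      have hfin : s.Finite := u.finite_toSet.subset hsu
      refine Set.mem_iUnion₂.2 ⟨hfin.toFinset, ?_, by simp⟩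
      refine mem_filter.2 ⟨mem_powerset.2 fun x hx => hsu (hfin.mem_toFinset.1 hx), ?_⟩
      simpa [S] using hsS
    rw [h2]
    refine (measureReal_mono h3 (measure_ne_top _ _)).trans
      ((measureReal_biUnion_finset_le _ _).trans (le_of_eq ?_))
    refine sum_congr rfl fun T hT => ?_
    have hTu := mem_powerset.1 (mem_filter.1 hT).1
    rw [setBernoulli_real_singleton p (by exact_mod_cast hTu) u.finite_toSet, Set.ncard_coe_finset,
      ← coe_sdiff, Set.ncard_coe_finset]
  -- Exponential Markov inequality: weighting each missed element of `E` by `1 / 2` gives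
  -- expectation `(r ^ 2) ^ #E`, while on the event the weight is at least `r ^ #E`.
  let a : ι → ℝ := fun e => if e ∈ E then 1 / 2 else 1
  have h4 : ∑ T ∈ u.powerset, (∏ _e ∈ T, (p : ℝ)) * ∏ e ∈ u \ T, ((1 - p : ℝ) * a e) =
      (r ^ 2) ^ #E := by
    rw [← prod_add]
    have h5 : ∀ e ∈ u, (p : ℝ) + (1 - p : ℝ) * a e = if e ∈ E then r ^ 2 else 1 := by
      intro e _
      by_cases he : e ∈ E
      · simp only [a, he, if_true, hrp]
        ring
      · simp [a, he]
    rw [prod_congr rfl h5, prod_ite, prod_const_one, mul_one, prod_const, filter_mem_eq_inter,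
      inter_eq_right.2 hEu]
  have h6 : ∀ T ∈ 𝒯, (p : ℝ) ^ #T * (1 - p : ℝ) ^ #(u \ T) * r ^ #E ≤
      (∏ _e ∈ T, (p : ℝ)) * ∏ e ∈ u \ T, ((1 - p : ℝ) * a e) := by
    intro T hT
    obtain ⟨hTu, hTN⟩ := mem_filter.1 hT
    have h7 : ∏ e ∈ u \ T, a e = (1 / 2) ^ #{e ∈ E | e ∉ T} := by
      have h8 : {e ∈ u \ T | e ∈ E} = {e ∈ E | e ∉ T} := by
        ext e
        simp only [mem_filter, Finset.mem_sdiff]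
        exact ⟨fun h => ⟨h.2, h.1.2⟩, fun h => ⟨⟨hEu h.1, h.2⟩, h.1⟩⟩
      simp only [a]
      rw [prod_ite, prod_const_one, mul_one, prod_const, h8]
    rw [prod_mul_distrib, prod_const, prod_const, h7, mul_assoc]
    have h9 : r ^ #E ≤ (1 / 2) ^ #{e ∈ E | e ∉ T} := by
      calc r ^ #E ≤ r ^ (N * #{e ∈ E | e ∉ T}) := pow_le_pow_of_le_one hr.le hr1 hTN
        _ = (r ^ N) ^ #{e ∈ E | e ∉ T} := pow_mul _ _ _
        _ ≤ _ := by gcongr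
    gcongr
  refine le_of_mul_le_mul_right ?_ (by positivity : 0 < r ^ #E)
  calc (setBernoulli (u : Set ι) p).real S * r ^ #E
      ≤ (∑ T ∈ 𝒯, (p : ℝ) ^ #T * (1 - p : ℝ) ^ #(u \ T)) * r ^ #E := by gcongr
    _ ≤ ∑ T ∈ 𝒯, (∏ _e ∈ T, (p : ℝ)) * ∏ e ∈ u \ T, ((1 - p : ℝ) * a e) := by
        rw [sum_mul]
        exact sum_le_sum h6
    _ ≤ ∑ T ∈ u.powerset, (∏ _e ∈ T, (p : ℝ)) * ∏ e ∈ u \ T, ((1 - p : ℝ) * a e) := by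
        refine sum_le_sum_of_subset_of_nonneg (filter_subset _ _) fun T _ _ => ?_
        refine mul_nonneg (prod_nonneg fun _ _ => hp0) (prod_nonneg fun e _ => mul_nonneg hp1 ?_)
        simp only [a]
        split_ifs <;> norm_num
    _ = r ^ #E * r ^ #E := by rw [h4]; ring

open Finset Classical in
/-- The unordered pairs of distinct vertices, one from `A` and one from `B`. -/
noncomputable def pairsBetween {V : Type u} (A B : Finset V) : Finset (Sym2 V) :=
  {e ∈ (A ×ˢ B).image (fun q => s(q.1, q.2)) | ¬ e.IsDiag}

theorem not_isDiag_of_mem_pairsBetween {V : Type u} {A B : Finset V} {e : Sym2 V}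
    (he : e ∈ pairsBetween A B) : ¬ e.IsDiag := by
  classical
  exact (Finset.mem_filter.1 he).2

-- One factor `2` for the diagonal, at most half of `A × B` as `#B ≥ 2`, and one for the two orders
-- of a pair.
open Finset Classical in
theorem card_mul_card_le_pairsBetween {V : Type u} (A B : Finset V) (hB : 2 ≤ #B) :
    #A * #B ≤ 4 * #(pairsBetween A B) := by
  have h1 : #{q ∈ A ×ˢ B | q.1 = q.2} ≤ #A := by
    refine card_le_card_of_injOn Prod.fst (fun q hq => ?_) ?_
    · exact (mem_product.1 (mem_filter.1 hq).1).1
    · rintro ⟨x, y⟩ hq ⟨x', y'⟩ hq' (rfl : x = x')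
      have h2 : x = y := (mem_filter.1 hq).2
      have h3 : x = y' := (mem_filter.1 hq').2
      rw [← h2, ← h3]
  have h2 : #{q ∈ A ×ˢ B | ¬ q.1 = q.2} ≤ 2 * #(pairsBetween A B) := by
    refine card_le_mul_card_image_of_maps_to (f := fun q => s(q.1, q.2)) (fun q hq => ?_) 2 ?_
    · obtain ⟨hq, hne⟩ := mem_filter.1 hq
      exact mem_filter.2 ⟨mem_image_of_mem _ hq, by simpa using hne⟩
    · intro e _
      induction e with
      | _ x y =>
        refine (card_le_card (t := {(x, y), (y, x)}) ?_).trans card_le_two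
        rintro ⟨x', y'⟩ hq
        have := (mem_filter.1 hq).2
        rw [Sym2.eq_iff] at this
        simp only [mem_insert, mem_singleton, Prod.mk.injEq]
        exact this
  have h3 := card_filter_add_card_filter_not (s := A ×ˢ B) (fun q => q.1 = q.2)
  rw [card_product] at h3
  nlinarith

open Finset Classical in
theorem exists_missing_few_of_not_isSparse {V : Type u} {Γ : SimpleGraph V} {t : ℝ} {N : ℕ}
    (ht : 2 ≤ t) (hN : 0 < N) (h : ¬ IsSparse Γ (1 / (4 * N)) t) :
    ∃ A B : Finset V, t ≤ #A ∧ t ≤ #B ∧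
      N * #{e ∈ pairsBetween A B | e ∉ Γ.edgeSet} ≤ #(pairsBetween A B) := by
  unfold IsSparse at h
  push Not at h
  obtain ⟨A, B, hA, hB, hAB⟩ := h
  refine ⟨A, B, hA, hB, ?_⟩
  have h1 := card_mul_card_le_pairsBetween A B (by exact_mod_cast ht.trans hB)
  have h2 : #{e ∈ pairsBetween A B | e ∉ Γ.edgeSet} ≤ #{q ∈ A ×ˢ B | ¬ Γ.Adj q.1 q.2} := by
    refine (card_le_card (t := ({q ∈ A ×ˢ B | ¬ Γ.Adj q.1 q.2}).image fun q => s(q.1, q.2)) ?_).trans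
      card_image_le
    intro e he
    obtain ⟨he, heΓ⟩ := mem_filter.1 he
    obtain ⟨q, hq, rfl⟩ := mem_image.1 (mem_filter.1 he).1
    exact mem_image_of_mem _ (mem_filter.2 ⟨hq, heΓ⟩)
  have h3 := card_filter_add_card_filter_not (s := A ×ˢ B) (fun q => Γ.Adj q.1 q.2)
  rw [card_product] at h3
  have h4 : #(Γ.interedges A B) = #{q ∈ A ×ˢ B | Γ.Adj q.1 q.2} := by
    congr 1
  rw [h4] at hAB
  have h5 : (#{q ∈ A ×ˢ B | Γ.Adj q.1 q.2} : ℝ) + #{q ∈ A ×ˢ B | ¬ Γ.Adj q.1 q.2} = #A * #B := by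
    exact_mod_cast h3
  have h6 : (#{e ∈ pairsBetween A B | e ∉ Γ.edgeSet} : ℝ) ≤ #{q ∈ A ×ˢ B | ¬ Γ.Adj q.1 q.2} := by
    exact_mod_cast h2
  have h7 : (#A * #B : ℝ) ≤ 4 * #(pairsBetween A B) := by exact_mod_cast h1
  have hN' : (0 : ℝ) < N := by exact_mod_cast hN
  have h8 : (#{q ∈ A ×ˢ B | ¬ Γ.Adj q.1 q.2} : ℝ) ≤ 1 / (4 * N) * (#A * #B) := by
    have : (1 - 1 / (4 * N)) * (#A : ℝ) * #B = #A * #B - 1 / (4 * N) * (#A * #B) := by ring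
    linarith
  rw [one_div_mul_eq_div, le_div_iff₀ (by positivity)] at h8
  have h9 : (N * #{e ∈ pairsBetween A B | e ∉ Γ.edgeSet} : ℝ) ≤ #(pairsBetween A B) := by
    have := mul_le_mul_of_nonneg_left h6 hN'.le
    linarith
  exact_mod_cast h9

-- Union bound over at most `4 ^ n` pairs `(A, B)`, each spanning at least `t ^ 2 / 4` potential
-- edges.
open MeasureTheory ProbabilityTheory Finset Classical in
theorem binomialRandom_real_not_isSparse_le (n : ℕ) (p : unitInterval) {r t : ℝ} {N : ℕ}
    (hr : 0 < r) (hr1 : r ≤ 1) (hrp : r ^ 2 = (1 + (p : ℝ)) / 2) (hN : r ^ N ≤ 1 / 2)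
    (ht : 2 ≤ t) :
    (SimpleGraph.binomialRandom (Fin n) p).real {Γ | ¬ IsSparse Γ (1 / (4 * N)) t} ≤
      4 ^ n * r ^ (t ^ 2 / 4) := by
  have hN0 : 0 < N := by
    rcases Nat.eq_zero_or_pos N with rfl | h
    · norm_num at hN
    · exact h
  let 𝒜 : Finset (Finset (Fin n) × Finset (Fin n)) := {q | t ≤ #q.1 ∧ t ≤ #q.2}
  let bad : Finset (Fin n) × Finset (Fin n) → Set (SimpleGraph (Fin n)) := fun q =>
    {Γ | N * #{e ∈ pairsBetween q.1 q.2 | e ∉ Γ.edgeSet} ≤ #(pairsBetween q.1 q.2)}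
  have hsub : {Γ : SimpleGraph (Fin n) | ¬ IsSparse Γ (1 / (4 * N)) t} ⊆ ⋃ q ∈ 𝒜, bad q := by
    intro Γ hΓ
    obtain ⟨A, B, hA, hB, h⟩ := exists_missing_few_of_not_isSparse ht hN0 hΓ
    exact Set.mem_iUnion₂.2 ⟨(A, B), mem_filter.2 ⟨mem_univ _, hA, hB⟩, h⟩
  have hbad : ∀ q ∈ 𝒜, (SimpleGraph.binomialRandom (Fin n) p).real (bad q) ≤ r ^ (t ^ 2 / 4) := by
    rintro ⟨A, B⟩ hq
    obtain ⟨-, hA, hB⟩ := mem_filter.1 hq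
    let u : Finset (Sym2 (Fin n)) := {e | ¬ e.IsDiag}
    have hu : (Sym2.diagSetᶜ : Set (Sym2 (Fin n))) = (u : Set (Sym2 (Fin n))) := by
      ext e
      simp [u]
    have h1 : (SimpleGraph.binomialRandom (Fin n) p).real (bad (A, B)) ≤
        (setBernoulli (u : Set (Sym2 (Fin n))) p).real
          {s | N * #{e ∈ pairsBetween A B | e ∉ s} ≤ #(pairsBetween A B)} := by
      rw [measureReal_def, SimpleGraph.binomialRandom_apply', hu, ← measureReal_def]
      refine measureReal_mono ?_ (measure_ne_top _ _)
      rintro s ⟨Γ, hΓ, rfl⟩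
      refine le_of_eq_of_le (congrArg (N * ·) (congrArg card ?_)) hΓ
      ext e
      simp only [mem_filter]
    have h2 := setBernoulli_real_miss_few_le p (pairsBetween A B) u
      (fun e he => mem_filter.2 ⟨mem_univ _, not_isDiag_of_mem_pairsBetween he⟩) hr hr1 hrp hN
    refine h1.trans (h2.trans ?_)
    rw [← Real.rpow_natCast]
    refine Real.rpow_le_rpow_of_exponent_ge hr hr1 ?_
    have h3 := card_mul_card_le_pairsBetween A B (by exact_mod_cast ht.trans hB)
    have h4 : (#A * #B : ℝ) ≤ 4 * #(pairsBetween A B) := by exact_mod_cast h3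
    have h5 : t * t ≤ #A * #B := by gcongr
    linarith [sq t]
  calc _ ≤ (SimpleGraph.binomialRandom (Fin n) p).real (⋃ q ∈ 𝒜, bad q) :=
        measureReal_mono hsub (measure_ne_top _ _)
    _ ≤ ∑ q ∈ 𝒜, (SimpleGraph.binomialRandom (Fin n) p).real (bad q) :=
        measureReal_biUnion_finset_le _ _
    _ ≤ #𝒜 * r ^ (t ^ 2 / 4) := by
        rw [← nsmul_eq_mul]
        exact sum_le_card_nsmul _ _ _ hbad
    _ ≤ _ := by
        have h6 : #𝒜 ≤ 4 ^ n := by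
          refine (card_le_univ _).trans (le_of_eq ?_)
          simp only [Fintype.card_prod, Fintype.card_finset, Fintype.card_fin, ← mul_pow]
          norm_num
        have h7 : (#𝒜 : ℝ) ≤ 4 ^ n := by exact_mod_cast h6
        gcongr

/-- The exponent is of order `n ^ (3 / 2)`, which beats `4 ^ n`. -/
theorem tendsto_four_pow_mul_rpow {r : ℝ} (hr : 0 < r) (hr1 : r < 1) :
    Tendsto (fun n : ℕ => (4 : ℝ) ^ n * r ^ (((n : ℝ) ^ (3 / 4 : ℝ)) ^ 2 / 4)) atTop (𝓝 0) := by
  have h1 : Tendsto (fun n : ℕ => r ^ ((n : ℝ) ^ (1 / 2 : ℝ) / 4)) atTop (𝓝 0) :=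
    (tendsto_rpow_atTop_of_base_lt_one r (by linarith) hr1).comp
      (((tendsto_rpow_atTop (by norm_num : (0 : ℝ) < 1 / 2)).comp
        tendsto_natCast_atTop_atTop).atTop_div_const (by norm_num))
  have h2 : ∀ᶠ n : ℕ in atTop, r ^ ((n : ℝ) ^ (1 / 2 : ℝ) / 4) < 1 / 8 :=
    h1.eventually_lt_const (by norm_num)
  refine squeeze_zero' (Eventually.of_forall fun n => by positivity) ?_
    (tendsto_pow_atTop_nhds_zero_of_lt_one (r := (1 / 2 : ℝ)) (by norm_num) (by norm_num))
  filter_upwards [h2] with n hn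
  have h3 : r ^ (((n : ℝ) ^ (3 / 4 : ℝ)) ^ 2 / 4) = (r ^ ((n : ℝ) ^ (1 / 2 : ℝ) / 4)) ^ n := by
    rw [← Real.rpow_natCast (r ^ _) n, ← Real.rpow_mul hr.le]
    congr 1
    rw [← Real.rpow_natCast _ 2, ← Real.rpow_mul (by positivity),
      show (3 / 4 : ℝ) * (2 : ℕ) = 1 / 2 + 1 by norm_num,
      Real.rpow_add_one' (by positivity) (by norm_num)]
    ring
  rw [h3, ← mul_pow]
  gcongr
  linarith

theorem tendsto_binomialRandom_not_isSparse {p : unitInterval} (hp : p < 1) :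
    ∃ c : ℝ, 0 < c ∧ Tendsto (fun n : ℕ => SimpleGraph.binomialRandom (Fin n) p
      {Γ | ¬ IsSparse Γ c ((n : ℝ) ^ (3 / 4 : ℝ))}) atTop (𝓝 0) := by
  have hp0 : 0 ≤ (p : ℝ) := p.2.1
  have hp1 : (p : ℝ) < 1 := hp
  set r : ℝ := √((1 + (p : ℝ)) / 2) with hr_def
  have hrp : r ^ 2 = (1 + (p : ℝ)) / 2 := Real.sq_sqrt (by positivity)
  have hr : 0 < r := Real.sqrt_pos.2 (by positivity)
  have hr1 : r < 1 := by nlinarith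
  obtain ⟨N, hN⟩ := exists_pow_lt_of_lt_one (by norm_num : (0 : ℝ) < 1 / 2) hr1
  have hN0 : 0 < N := by
    rcases Nat.eq_zero_or_pos N with rfl | h
    · norm_num at hN
    · exact h
  refine ⟨1 / (4 * N), by positivity, ?_⟩
  have h1 : ∀ᶠ n : ℕ in atTop, 2 ≤ (n : ℝ) ^ (3 / 4 : ℝ) :=
    ((tendsto_rpow_atTop (by norm_num : (0 : ℝ) < 3 / 4)).comp
      tendsto_natCast_atTop_atTop).eventually_ge_atTop 2
  rw [← ENNReal.tendsto_toReal_iff (fun n => MeasureTheory.measure_ne_top _ _) (by simp)]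
  refine squeeze_zero' (Eventually.of_forall fun n => ENNReal.toReal_nonneg) ?_
    (tendsto_four_pow_mul_rpow hr hr1)
  filter_upwards [h1] with n hn
  exact binomialRandom_real_not_isSparse_le n p hr hr1.le hrp hN.le hn

/-! ### The Turán number of the random graph -/

theorem isBipartiteDegreeLE_of_isBipartite {W : Type u} [Finite W] {H : SimpleGraph W}
    (hH : H.IsBipartite) : IsBipartiteDegreeLE H (Nat.card W + 1) := by
  obtain ⟨κ⟩ := hH
  refine ⟨{w | κ w = 0}, {w | κ w ≠ 0}, ⟨?_, ?_⟩, ?_, fun a _ => ?_⟩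
  · exact Set.disjoint_left.2 fun w hw hw' => hw' hw
  · intro w w' h
    have := κ.valid h
    simp only [Set.mem_ofPred_eq]
    omega
  · ext w
    simp [em]
  · exact (Set.ncard_le_card _).trans (Nat.le_succ _)

/-- Non-edges of the copy are non-edges of `Γ`, hence of `G`, so the copy is induced in `G` as well.
-/
theorem not_property_of_hasCopyInducedIn {P : GraphProperty} (hP : P.IsHereditary) {W V : Type}
    [Finite W] [Finite V] {H : SimpleGraph W} (hH : ¬ P W H) {Γ : SimpleGraph V} {G : Γ.Subgraph}
    (h : HasCopyInducedIn H Γ G) : ¬ P G.verts G.coe := by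
  intro hG
  obtain ⟨f, hf, hfG⟩ := h
  refine hH (hP W G.verts H G.coe ⟨⟨⟨fun w => ⟨f w, hf w⟩, fun w w' h => ?_⟩, fun {w w'} => ?_⟩⟩ hG)
  · exact f.injective (congrArg Subtype.val h)
  · exact ⟨fun h => f.map_adj_iff.1 (G.adj_sub h), fun h => hfG w w' h⟩

theorem ex_le_of_forall {V : Type} [Finite V] {Γ : SimpleGraph V} {P : GraphProperty} {x : ℝ}
    (hx : 0 ≤ x) (h : ∀ G : Γ.Subgraph, P G.verts G.coe → (G.edgeSet.ncard : ℝ) ≤ x) :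
    (ex Γ P : ℝ) ≤ x := by
  have h1 : ex Γ P ≤ ⌊x⌋₊ := by
    refine csSup_le' ?_
    rintro k ⟨G, hG, rfl⟩
    exact Nat.le_floor (h G hG)
  exact (Nat.cast_le.2 h1).trans (Nat.floor_le hx)

theorem exists_tendsto_ex_le (P : GraphProperty) (hP : P.IsHereditary)
    (hPb : P.MissesBipartite) :
    ∃ ε : ℝ, 0 < ε ∧ ∀ p : unitInterval, p < 1 →
      Tendsto (fun n : ℕ => SimpleGraph.binomialRandom (Fin n) p
        {Γ : SimpleGraph (Fin n) | (ex Γ P : ℝ) ≤ (n : ℝ) ^ (2 - ε)}) atTop (𝓝 1) := by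
  obtain ⟨W, _, H, hHb, hH⟩ := hPb
  set d : ℕ := Nat.card W + 1 with hd
  have hd0 : (0 : ℝ) < d := by simp only [hd]; positivity
  -- With `t = n ^ (3 / 4)` the exponent is `3 / (4 * d) + 2 - 1 / d = 2 - 1 / (4 * d)`; half of the
  -- gain absorbs `C`. Only `C` and `c` depend on `p`.
  refine ⟨1 / (8 * d), by positivity, fun p hp => ?_⟩
  obtain ⟨c, hc, hsparse⟩ := tendsto_binomialRandom_not_isSparse hp
  obtain ⟨C, hC, hcopy⟩ := exists_uniform_const_hasCopyInducedIn.{0, 0} H hc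
  have hbig : ∀ᶠ n : ℕ in atTop, C ≤ (n : ℝ) ^ (1 / (8 * (d : ℝ))) :=
    ((tendsto_rpow_atTop (by positivity : (0 : ℝ) < 1 / (8 * (d : ℝ)))).comp
      tendsto_natCast_atTop_atTop).eventually_ge_atTop C
  have hlow : Tendsto (fun n : ℕ => 1 - SimpleGraph.binomialRandom (Fin n) p
      {Γ | ¬ IsSparse Γ c ((n : ℝ) ^ (3 / 4 : ℝ))}) atTop (𝓝 1) := by
    simpa using ENNReal.Tendsto.sub tendsto_const_nhds hsparse (Or.inl ENNReal.one_ne_top)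
  refine tendsto_of_tendsto_of_tendsto_of_le_of_le' hlow tendsto_const_nhds ?_
    (Eventually.of_forall fun n => MeasureTheory.prob_le_one)
  filter_upwards [hbig, eventually_ge_atTop 1] with n hn hn1
  have hn0 : (0 : ℝ) < n := by exact_mod_cast hn1
  have : NeZero n := ⟨by omega⟩
  set S : Set (SimpleGraph (Fin n)) :=
    {Γ | (ex Γ P : ℝ) ≤ (n : ℝ) ^ (2 - 1 / (8 * (d : ℝ)))} with hS
  set T : Set (SimpleGraph (Fin n)) := {Γ | ¬ IsSparse Γ c ((n : ℝ) ^ (3 / 4 : ℝ))} with hT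
  have hcover : (Set.univ : Set (SimpleGraph (Fin n))) ⊆ S ∪ T := by
    intro Γ _
    by_cases hΓ : IsSparse Γ c ((n : ℝ) ^ (3 / 4 : ℝ))
    · left
      refine ex_le_of_forall (by positivity) fun G hG => ?_
      have h1 := fun h => not_property_of_hasCopyInducedIn hP hH
        (hcopy d (by omega) (isBipartiteDegreeLE_of_isBipartite hHb) (Fin n) Γ _
          (by positivity) hΓ G h) hG
      refine (not_le.1 h1).le.trans ?_
      rw [Nat.card_eq_fintype_card, Fintype.card_fin, ← Real.rpow_mul hn0.le]
      calc C * (n : ℝ) ^ (3 / 4 * (1 / (d : ℝ))) * (n : ℝ) ^ (2 - 1 / (d : ℝ))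
          ≤ (n : ℝ) ^ (1 / (8 * (d : ℝ))) * (n : ℝ) ^ (3 / 4 * (1 / (d : ℝ))) *
            (n : ℝ) ^ (2 - 1 / (d : ℝ)) := by gcongr
        _ = (n : ℝ) ^ (2 - 1 / (8 * (d : ℝ))) := by
            rw [← Real.rpow_add hn0, ← Real.rpow_add hn0]
            congr 1
            field_simp
            ring
    · right
      exact hΓ
  rw [tsub_le_iff_right]
  calc (1 : ENNReal) = SimpleGraph.binomialRandom (Fin n) p Set.univ :=
        MeasureTheory.measure_univ.symm
    _ ≤ SimpleGraph.binomialRandom (Fin n) p (S ∪ T) := MeasureTheory.measure_mono hcover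
    _ ≤ _ := MeasureTheory.measure_union_le _ _

end InducedTuran

theorem corollary1p2 :
    (∀ (W : Type u) [Finite W] (H : SimpleGraph W) (c : ℝ), 0 < c →
      ∃ C : ℝ, 0 < C ∧ ∀ d : ℕ, 1 ≤ d → InducedTuran.IsBipartiteDegreeLE H d →
        ∀ (V : Type v) [Finite V] [Nonempty V] (Γ : SimpleGraph V) (t : ℝ), 0 < t →
          InducedTuran.IsSparse Γ c t →
          ∀ G : Γ.Subgraph,
            C * t ^ (1 / (d : ℝ)) * (Nat.card V : ℝ) ^ (2 - 1 / (d : ℝ)) ≤ (G.edgeSet.ncard : ℝ) →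
            InducedTuran.HasCopyInducedIn H Γ G) ∧
    (∀ P : InducedTuran.GraphProperty, P.IsHereditary → P.IsNontrivial → P.MissesBipartite →
      ∃ ε : ℝ, 0 < ε ∧ ∀ p : unitInterval, 0 < p → p < 1 →
        Tendsto
          (fun n : ℕ => SimpleGraph.binomialRandom (Fin n) p
            {Γ : SimpleGraph (Fin n) | (InducedTuran.ex Γ P : ℝ) ≤ (n : ℝ) ^ (2 - ε)})
          atTop (𝓝 1)) :=
  ⟨fun _ _ H _ hc => InducedTuran.exists_uniform_const_hasCopyInducedIn H hc,
    fun P hP _ hPb =>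
      let ⟨ε, hε, h⟩ := InducedTuran.exists_tendsto_ex_le P hP hPb
      ⟨ε, hε, fun p _ hp => h p hp⟩⟩
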